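/- For positive integers $s_1,\dots,s_l$ with $s_l>1$ let $$\zeta(s_1,\dots,s_l)=\sum_{1\le k_1<k_2<\cdots<k_l}\frac{1}{k_1^{s_1}k_2^{s_2}\cdots k_l^{s_l}}$$ be the multiple zeta value, with $\zeta(\emptyset)=1$ for the empty index; let $\{2\}^d$ denote the sequence $2,\dots,2$ of length $d$, and for integers $r,s\ge 0$ put $H(r,s)=\zeta(\{2\}^r,3,\{2\}^s)$. Then for all integers $r,s\ge 0$ (all the series involved being convergent) $$H(r,s)=2\sum_{k=1}^{r+s+1}(-1)^k\,c^{(k)}_{r,s}\,\zeta(2k+1)\,\zeta(\{2\}^{r+s+1-k}),$$ where $\zeta(2k+1)$ is the value of the Riemann zeta function and $$c^{(k)}_{r,s}=\binom{2k}{2r+2}-\Bigl(1-\frac{1}{2^{2k}}\Bigr)\binom{2k}{2s+1}.$$ -/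

import Mathlib

/-- The strictly increasing sequences `1 ≤ k₁ < k₂ < ⋯ < k_l` of integers. -/
def IncrTuple (l : ℕ) : Type :=
  {k : Fin l → ℕ // StrictMono k ∧ ∀ i, 1 ≤ k i}

/-- The term `1 / (k₁ ^ s₁ * ⋯ * k_l ^ s_l)` of the multiple zeta series with index `s`. -/
noncomputable def mzvTerm (s : List ℕ) (k : IncrTuple s.length) : ℝ :=
  1 / ∏ i : Fin s.length, (k.1 i : ℝ) ^ s.get i

/-- The multiple zeta value `ζ(s₁, …, s_l)`, the sum over `1 ≤ k₁ < ⋯ < k_l`. For the empty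
index there is exactly one (empty) tuple and the value is `1`. -/
noncomputable def mzv (s : List ℕ) : ℝ :=
  ∑' k : IncrTuple s.length, mzvTerm s k

/-- The index `({2}^d)`. -/
def twos (d : ℕ) : List ℕ := List.replicate d 2

/-- The index `({2}^r, 3, {2}^s)`. -/
def hIndex (r s : ℕ) : List ℕ := twos r ++ 3 :: twos s

/-- `H(r, s) = ζ({2}^r, 3, {2}^s)`. -/
noncomputable def zagierH (r s : ℕ) : ℝ := mzv (hIndex r s)

/-- The coefficient `c^{(k)}_{r,s}`. -/
def zagierCoeff (k r s : ℕ) : ℚ :=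
  ((2 * k).choose (2 * r + 2) : ℚ) - (1 - 1 / 2 ^ (2 * k)) * ((2 * k).choose (2 * s + 1) : ℚ)

/-!
Let `ω_N` be `sin (θ / 2) ^ (2N)` normalised to have mean `1` on `[0, π]`. It satisfies
`ω_{N+1}'' = (N + 1)² (ω_N - ω_{N+1})`, so the iterated primitives `Iₙ` of order `n + 1` satisfy
`I_{n+2} ω_N - I_{n+2} ω_{N+1} = Iₙ ω_{N+1} / (N + 1)²`. This is the recursion of the tails of
`ζ({2}^d)` (the sums over tuples above `N`), which are therefore `I_{2d} ω_N (π) / π`. Integrating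
`I_{2r+1} ω_N (θ)` against `(π - θ)^{2s+1} cot (θ / 2) / (2s+1)!` gives the tails of
`ζ({2}^r, 3, {2}^s)` in the same way: `ω_{N+1} cot (θ / 2) = ω_{N+1}' / (N + 1)` supplies the third
power of `N + 1` at the entry `3`. At `N = 0` we have `ω_0 = 1`, and the integrand is
`θ^{2r+2} (π - θ)^{2s+1} cot (θ / 2)` up to a constant. Expanding `cot (θ / 2)` as `2 ∑ sin (n θ)`
and integrating by parts yields the zeta values, with coefficients given by derivatives of the
polynomial at `0` and at `π`.
-/

section

open Filter Topology Real MeasureTheory intervalIntegral Polynomial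
open Nat (factorial)

/-! ### Tails of multiple zeta series -/

/-- The strictly increasing sequences of `l` integers larger than `N`, the index set of the tails
of a multiple zeta series. For `N = 0` it unfolds to `IncrTuple l`. -/
def TupleAbove (N l : ℕ) : Type :=
  {k : Fin l → ℕ // StrictMono k ∧ ∀ i, N < k i}

/-- The term of the multiple zeta series with index `s` at a tuple above `N`. -/
noncomputable def tailTerm (N : ℕ) (s : List ℕ) (k : TupleAbove N s.length) : ℝ :=
  1 / ∏ i : Fin s.length, (k.1 i : ℝ) ^ s.get i

lemma tailTerm_nonneg (N : ℕ) (s : List ℕ) (k : TupleAbove N s.length) : 0 ≤ tailTerm N s k := by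
  unfold tailTerm; positivity

/-- The tuple with first entry `N + 1 + m` and the remaining entries given by a tuple above it. -/
def TupleAbove.cons {N l : ℕ} (x : Σ m : ℕ, TupleAbove (N + 1 + m) l) : TupleAbove N (l + 1) :=
  ⟨Fin.cons (N + 1 + x.1) x.2.1, Fin.strictMono_cons.2 ⟨x.2.2.2, x.2.2.1⟩, Fin.forall_fin_succ.2
    ⟨by rw [Fin.cons_zero]; omega, fun j => by have := x.2.2.2 j; rw [Fin.cons_succ]; omega⟩⟩

lemma TupleAbove.cons_bijective (N l : ℕ) :
    Function.Bijective (TupleAbove.cons : _ → TupleAbove N (l + 1)) := by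
  constructor
  · rintro ⟨m, k, hk⟩ ⟨m', k', hk'⟩ h
    obtain ⟨hm, rfl⟩ := (Fin.cons_inj (α := fun _ => ℕ)).1 (congrArg Subtype.val h)
    obtain rfl := Nat.add_left_cancel hm
    rfl
  · rintro ⟨k, hk, hN⟩
    have hhead : N + 1 + (k 0 - (N + 1)) = k 0 := Nat.add_sub_cancel' (hN 0)
    refine ⟨⟨k 0 - (N + 1), Fin.tail k, hk.comp (Fin.strictMono_succ), fun i => ?_⟩, ?_⟩
    · rw [hhead]
      exact hk i.succ_pos
    · apply Subtype.ext
      simp only [TupleAbove.cons, hhead, Fin.cons_self_tail]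

lemma hasSum_tailTerm_nil (N : ℕ) : HasSum (tailTerm N []) 1 := by
  have : Unique (TupleAbove N ([] : List ℕ).length) :=
    { default := ⟨Fin.elim0, fun i => i.elim0, fun i => i.elim0⟩
      uniq := fun a => Subtype.ext (funext fun i => i.elim0) }
  simpa [tailTerm] using hasSum_unique (tailTerm N [])

lemma tailTerm_cons {N : ℕ} (a : ℕ) {s : List ℕ} (x : Σ m : ℕ, TupleAbove (N + 1 + m) s.length) :
    tailTerm N (a :: s) (TupleAbove.cons x)
      = tailTerm (N + 1 + x.1) s x.2 / ((N + 1 + x.1 : ℕ) : ℝ) ^ a := by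
  change 1 / ∏ i : Fin (s.length + 1), _ = _
  rw [Fin.prod_univ_succ]
  simp only [tailTerm, TupleAbove.cons, Fin.cons_zero, Fin.cons_succ, List.get_cons_zero,
    List.get_cons_succ']
  rw [div_div, mul_comm]

lemma hasSum_tailTerm_cons {N a : ℕ} {s : List ℕ} {f : ℕ → ℝ} {v : ℝ}
    (hf : ∀ n, HasSum (tailTerm n s) (f n))
    (hv : HasSum (fun m => f (N + 1 + m) / ((N + 1 + m : ℕ) : ℝ) ^ a) v) :
    HasSum (tailTerm N (a :: s)) v := by
  let e := Equiv.ofBijective _ (TupleAbove.cons_bijective N s.length)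
  have hterm : tailTerm N (a :: s) ∘ e = fun x => tailTerm (N + 1 + x.1) s x.2 / _ :=
    funext (tailTerm_cons a)
  have hfib (m : ℕ) := (hf (N + 1 + m)).div_const (((N + 1 + m : ℕ) : ℝ) ^ a)
  refine e.hasSum_iff.1 ?_
  rw [hterm]
  refine hv.sigma_of_hasSum hfib <| (summable_sigma_of_nonneg fun x =>
    div_nonneg (tailTerm_nonneg _ _ _) (by positivity)).2 ⟨fun m => (hfib m).summable, ?_⟩
  simp only [(hfib _).tsum_eq]
  exact hv.summable

lemma hasSum_of_tendsto_zero_of_sub_eq {g t : ℕ → ℝ} (hg : Tendsto g atTop (𝓝 0))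
    (ht : ∀ n, 0 ≤ t n) (hgt : ∀ n, g n - g (n + 1) = t (n + 1)) (N : ℕ) :
    HasSum (fun m => t (N + 1 + m)) (g N) := by
  rw [hasSum_iff_tendsto_nat_of_nonneg fun m => ht _]
  have hpartial (n : ℕ) : ∑ i ∈ Finset.range n, t (N + 1 + i) = g N - g (N + n) := by
    have htelescope := Finset.sum_range_sub' (fun i => g (N + i)) n
    rw [add_zero] at htelescope
    rw [← htelescope]
    refine Finset.sum_congr rfl fun i _ => ?_
    rw [add_right_comm, ← hgt, add_assoc]
  have hshift : Tendsto (fun n => g (N + n)) atTop (𝓝 0) := by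
    simpa only [add_comm] using (tendsto_add_atTop_iff_nat N).2 hg
  simpa only [hpartial, sub_zero] using hshift.const_sub (g N)

lemma hasSum_tailTerm_cons_of_sub_eq {a : ℕ} {s : List ℕ} {f g : ℕ → ℝ}
    (hf : ∀ n, HasSum (tailTerm n s) (f n)) (hg : Tendsto g atTop (𝓝 0))
    (hgf : ∀ n, g n - g (n + 1) = f (n + 1) / ((n + 1 : ℕ) : ℝ) ^ a) (N : ℕ) :
    HasSum (tailTerm N (a :: s)) (g N) := by
  have hf_nonneg (n : ℕ) : 0 ≤ f n := (hf n).nonneg (tailTerm_nonneg n s)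
  exact hasSum_tailTerm_cons hf <| hasSum_of_tendsto_zero_of_sub_eq
    (t := fun n => f n / (n : ℝ) ^ a) hg (fun n => div_nonneg (hf_nonneg n) (by positivity)) hgf N

/-! ### Iterated primitives -/

/-- The divided power `x ^ n / n!`, the kernel of Cauchy's formula for iterated primitives. -/
noncomputable def dividedPow (n : ℕ) (x : ℝ) : ℝ := x ^ n / factorial n

@[fun_prop]
lemma continuous_dividedPow (n : ℕ) : Continuous (dividedPow n) := by
  unfold dividedPow; fun_prop

@[simp]
lemma dividedPow_zero_left (x : ℝ) : dividedPow 0 x = 1 := by simp [dividedPow]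

@[simp]
lemma dividedPow_succ_zero (n : ℕ) : dividedPow (n + 1) 0 = 0 := by simp [dividedPow]

lemma dividedPow_nonneg (n : ℕ) {x : ℝ} (hx : 0 ≤ x) : 0 ≤ dividedPow n x := by
  unfold dividedPow; positivity

lemma dividedPow_le_pow (n : ℕ) {x : ℝ} (hx : 0 ≤ x) : dividedPow n x ≤ x ^ n :=
  div_le_self (pow_nonneg hx n) (mod_cast n.factorial_pos)

lemma hasDerivAt_dividedPow (n : ℕ) (x : ℝ) :
    HasDerivAt (dividedPow (n + 1)) (dividedPow n x) x := by
  refine ((hasDerivAt_pow (n + 1) x).div_const _).congr_deriv ?_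
  rw [Nat.factorial_succ, dividedPow, Nat.cast_mul, Nat.add_sub_cancel,
    mul_div_mul_left _ _ (by positivity)]

lemma hasDerivAt_dividedPow_const_sub (n : ℕ) (c x : ℝ) :
    HasDerivAt (fun y => dividedPow (n + 1) (c - y)) (-dividedPow n (c - x)) x := by
  simpa using (hasDerivAt_dividedPow n (c - x)).comp_const_sub c x

/-- The primitive of `f` of order `n + 1` that vanishes at `0` to that order, written as a single
integral by Cauchy's formula. -/
noncomputable def iterPrimitive (n : ℕ) (f : ℝ → ℝ) (s : ℝ) : ℝ :=
  ∫ y in 0..s, dividedPow n (s - y) * f y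

lemma continuous_iterPrimitive (n : ℕ) {f : ℝ → ℝ} (hf : Continuous f) :
    Continuous (iterPrimitive n f) :=
  continuous_parametric_intervalIntegral_of_continuous (by fun_prop) continuous_id

lemma iterPrimitive_nonneg (n : ℕ) {f : ℝ → ℝ} (hf : ∀ x, 0 ≤ f x) {s : ℝ} (hs : 0 ≤ s) :
    0 ≤ iterPrimitive n f s :=
  integral_nonneg hs fun y hy => mul_nonneg (dividedPow_nonneg n (sub_nonneg.2 hy.2)) (hf y)

lemma iterPrimitive_const_mul_sub (n : ℕ) (c : ℝ) {f g : ℝ → ℝ} (hf : Continuous f)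
    (hg : Continuous g) (s : ℝ) :
    iterPrimitive n (fun x => c * (f x - g x)) s
      = c * (iterPrimitive n f s - iterPrimitive n g s) := by
  simp only [iterPrimitive]
  rw [← integral_sub (Continuous.intervalIntegrable (by fun_prop) _ _)
    (Continuous.intervalIntegrable (by fun_prop) _ _), ← intervalIntegral.integral_const_mul]
  exact integral_congr fun y _ => by ring

lemma iterPrimitive_zero_deriv {f f' : ℝ → ℝ} (hf : ∀ x, HasDerivAt f (f' x) x)
    (hf' : Continuous f') (hf0 : f 0 = 0) (s : ℝ) : iterPrimitive 0 f' s = f s := by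
  simp only [iterPrimitive, dividedPow_zero_left, one_mul]
  rw [integral_eq_sub_of_hasDerivAt (fun x _ => hf x) (hf'.intervalIntegrable _ _), hf0, sub_zero]

lemma iterPrimitive_succ_deriv (n : ℕ) {f f' : ℝ → ℝ} (hf : ∀ x, HasDerivAt f (f' x) x)
    (hf' : Continuous f') (hf0 : f 0 = 0) (s : ℝ) :
    iterPrimitive (n + 1) f' s = iterPrimitive n f s := by
  have hparts := integral_mul_deriv_eq_deriv_mul (a := 0) (b := s)
    (fun x _ => hasDerivAt_dividedPow_const_sub n s x) (fun x _ => hf x)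
    (Continuous.intervalIntegrable (by fun_prop) _ _) (hf'.intervalIntegrable _ _)
  simpa [hf0, iterPrimitive] using hparts

lemma iterPrimitive_one (n : ℕ) (s : ℝ) :
    iterPrimitive n (fun _ => 1) s = dividedPow (n + 1) s := by
  have hFTC := integral_eq_sub_of_hasDerivAt (a := 0) (b := s)
    (fun x _ => hasDerivAt_dividedPow_const_sub n s x)
    (Continuous.intervalIntegrable (by fun_prop) _ _)
  simpa [iterPrimitive] using hFTC

/-! ### Powers of the sine -/

/-- The product `2 · 4 ⋯ (2N) / (1 · 3 ⋯ (2N - 1))`, whose inverse is the mean of `sin ^ (2N)`. -/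
noncomputable def wallisRatio (N : ℕ) : ℝ := ∏ i ∈ Finset.range N, ((2 * i + 2) / (2 * i + 1) : ℝ)

lemma wallisRatio_pos (N : ℕ) : 0 < wallisRatio N :=
  Finset.prod_pos fun i _ => by positivity

lemma wallisRatio_succ (N : ℕ) :
    wallisRatio (N + 1) = wallisRatio N * ((2 * N + 2) / (2 * N + 1)) :=
  Finset.prod_range_succ _ N

lemma wallisRatio_sq (N : ℕ) : wallisRatio N ^ 2 = (2 * N + 1) * Real.Wallis.W N := by
  induction N with
  | zero => simp [wallisRatio, Real.Wallis.W]
  | succ N ih =>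
    rw [wallisRatio_succ, Real.Wallis.W_succ, mul_pow, ih]
    push_cast
    field_simp
    ring

lemma tendsto_wallisRatio_div : Tendsto (fun N : ℕ => wallisRatio N / (2 * N + 1)) atTop (𝓝 0) := by
  have hsq (N : ℕ) : (wallisRatio N / (2 * N + 1)) ^ 2 = Real.Wallis.W N / (2 * N + 1) := by
    rw [div_pow, wallisRatio_sq, sq (2 * (N : ℝ) + 1), mul_div_mul_left _ _ (by positivity)]
  have hdenom : Tendsto (fun N : ℕ => 2 * (N : ℝ) + 1) atTop atTop :=
    tendsto_atTop_add_const_right _ _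
      (tendsto_natCast_atTop_atTop.const_mul_atTop two_pos)
  have hsqrt := (Real.Wallis.tendsto_W_nhds_pi_div_two.div_atTop hdenom).sqrt
  rw [Real.sqrt_zero] at hsqrt
  refine hsqrt.congr fun N => ?_
  rw [← hsq, Real.sqrt_sq (div_nonneg (wallisRatio_pos N).le (by positivity))]

/-- The function `sin (θ / 2) ^ (2N)`, normalised to have mean `1` on `[0, π]`. -/
noncomputable def sinPow (N : ℕ) (θ : ℝ) : ℝ := wallisRatio N * sin (θ / 2) ^ (2 * N)

/-- The derivative of `sinPow (N + 1)`. -/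
noncomputable def sinPowDeriv (N : ℕ) (θ : ℝ) : ℝ :=
  wallisRatio (N + 1) * ((N + 1) * sin (θ / 2) ^ (2 * N + 1) * cos (θ / 2))

lemma sinPow_zero : sinPow 0 = fun _ => 1 := by
  ext θ
  simp [sinPow, wallisRatio]

lemma sinPow_succ_zero (N : ℕ) : sinPow (N + 1) 0 = 0 := by simp [sinPow]

lemma sinPow_nonneg (N : ℕ) (θ : ℝ) : 0 ≤ sinPow N θ :=
  mul_nonneg (wallisRatio_pos N).le ((even_two_mul N).pow_nonneg _)

@[fun_prop]
lemma continuous_sinPow (N : ℕ) : Continuous (sinPow N) := by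
  unfold sinPow; fun_prop

@[fun_prop]
lemma continuous_sinPowDeriv (N : ℕ) : Continuous (sinPowDeriv N) := by
  unfold sinPowDeriv; fun_prop

lemma hasDerivAt_sin_half (θ : ℝ) : HasDerivAt (fun x => sin (x / 2)) (cos (θ / 2) / 2) θ := by
  simpa [div_eq_mul_inv] using ((hasDerivAt_id θ).div_const 2).sin

lemma hasDerivAt_cos_half (θ : ℝ) : HasDerivAt (fun x => cos (x / 2)) (-sin (θ / 2) / 2) θ := by
  simpa [div_eq_mul_inv] using ((hasDerivAt_id θ).div_const 2).cos

lemma hasDerivAt_sinPow_succ (N : ℕ) (θ : ℝ) :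
    HasDerivAt (sinPow (N + 1)) (sinPowDeriv N θ) θ := by
  refine (((hasDerivAt_sin_half θ).pow (2 * (N + 1))).const_mul _).congr_deriv ?_
  rw [sinPowDeriv, show 2 * (N + 1) - 1 = 2 * N + 1 by omega]
  push_cast
  ring

lemma hasDerivAt_sinPowDeriv (N : ℕ) (θ : ℝ) :
    HasDerivAt (sinPowDeriv N) ((N + 1) ^ 2 * (sinPow N θ - sinPow (N + 1) θ)) θ := by
  refine (((((hasDerivAt_sin_half θ).pow (2 * N + 1)).const_mul (N + 1 : ℝ)).mul
    (hasDerivAt_cos_half θ)).const_mul (wallisRatio (N + 1))).congr_deriv ?_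
  have hcos : cos (θ / 2) ^ 2 = 1 - sin (θ / 2) ^ 2 := cos_sq' _
  have hwallis : wallisRatio (N + 1) * (2 * N + 1) = wallisRatio N * (2 * N + 2) := by
    rw [wallisRatio_succ]; field_simp
  simp only [sinPow, Pi.pow_apply, Nat.add_sub_cancel]
  push_cast
  linear_combination (N + 1 : ℝ) * sin (θ / 2) ^ (2 * N) / 2 * hwallis
    + wallisRatio (N + 1) * (N + 1) * (2 * N + 1) * sin (θ / 2) ^ (2 * N) / 2 * hcos

lemma iterPrimitive_sinPow_sub_eq_div {n N : ℕ} {s v : ℝ}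
    (h : iterPrimitive n (fun x => (N + 1) ^ 2 * (sinPow N x - sinPow (N + 1) x)) s = v) :
    iterPrimitive n (sinPow N) s - iterPrimitive n (sinPow (N + 1)) s = v / (N + 1) ^ 2 := by
  rw [iterPrimitive_const_mul_sub _ _ (by fun_prop) (by fun_prop)] at h
  rw [← h, mul_div_cancel_left₀ _ (by positivity)]

lemma iterPrimitive_zero_sinPow_sub (N : ℕ) (s : ℝ) :
    iterPrimitive 0 (sinPow N) s - iterPrimitive 0 (sinPow (N + 1)) s
      = sinPowDeriv N s / (N + 1) ^ 2 :=
  iterPrimitive_sinPow_sub_eq_div <|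
    iterPrimitive_zero_deriv (hasDerivAt_sinPowDeriv N) (by fun_prop) (by simp [sinPowDeriv]) s

lemma iterPrimitive_succ_sinPow_sub (n N : ℕ) (s : ℝ) :
    iterPrimitive (n + 1) (sinPow N) s - iterPrimitive (n + 1) (sinPow (N + 1)) s
      = iterPrimitive n (sinPowDeriv N) s / (N + 1) ^ 2 :=
  iterPrimitive_sinPow_sub_eq_div <|
    iterPrimitive_succ_deriv n (hasDerivAt_sinPowDeriv N) (by fun_prop) (by simp [sinPowDeriv]) s

lemma iterPrimitive_one_sinPow_sub (N : ℕ) (s : ℝ) :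
    iterPrimitive 1 (sinPow N) s - iterPrimitive 1 (sinPow (N + 1)) s
      = sinPow (N + 1) s / (N + 1) ^ 2 := by
  rw [iterPrimitive_succ_sinPow_sub, iterPrimitive_zero_deriv (hasDerivAt_sinPow_succ N)
    (by fun_prop) (sinPow_succ_zero N)]

lemma iterPrimitive_add_two_sinPow_sub (n N : ℕ) (s : ℝ) :
    iterPrimitive (n + 2) (sinPow N) s - iterPrimitive (n + 2) (sinPow (N + 1)) s
      = iterPrimitive n (sinPow (N + 1)) s / (N + 1) ^ 2 := by
  rw [iterPrimitive_succ_sinPow_sub, iterPrimitive_succ_deriv n (hasDerivAt_sinPow_succ N)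
    (by fun_prop) (sinPow_succ_zero N)]

lemma iterPrimitive_zero_sinPow_pi (N : ℕ) : iterPrimitive 0 (sinPow N) π = π := by
  induction N with
  | zero => rw [sinPow_zero, iterPrimitive_one, dividedPow]; simp
  | succ N ih =>
    have hderiv : sinPowDeriv N π = 0 := by simp [sinPowDeriv]
    have hsub := iterPrimitive_zero_sinPow_sub N π
    rw [hderiv, zero_div] at hsub
    linarith

lemma dividedPow_succ_sub_le {n : ℕ} {s y : ℝ} (hs : s ≤ π) (hy : y ∈ Set.Icc 0 s) :
    dividedPow (n + 1) (s - y) ≤ π ^ (n + 1) * cos (y / 2) := by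
  have hjordan := one_sub_mul_le_cos (x := y / 2) (by linarith [hy.1]) (by linarith [hy.2])
  calc dividedPow (n + 1) (s - y) ≤ (s - y) ^ n * (s - y) :=
        dividedPow_le_pow _ (sub_nonneg.2 hy.2)
    _ ≤ π ^ n * (π * (1 - 2 / π * (y / 2))) := by
        have hlinear : π * (1 - 2 / π * (y / 2)) = π - y := by field_simp
        rw [hlinear]
        have := hy.1
        have := sub_nonneg.2 hy.2
        gcongr
        linarith
    _ ≤ π ^ (n + 1) * cos (y / 2) := by
        rw [pow_succ, mul_assoc]
        gcongr

lemma integral_cos_half_mul_sin_half_pow (N : ℕ) (s : ℝ) :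
    ∫ y in 0..s, cos (y / 2) * sin (y / 2) ^ (2 * N)
      = 2 * sin (s / 2) ^ (2 * N + 1) / (2 * N + 1) := by
  have hderiv (x : ℝ) : HasDerivAt (fun y => 2 * sin (y / 2) ^ (2 * N + 1) / (2 * N + 1))
      (cos (x / 2) * sin (x / 2) ^ (2 * N)) x := by
    refine ((((hasDerivAt_sin_half x).pow (2 * N + 1)).const_mul 2).div_const _).congr_deriv ?_
    rw [Nat.add_sub_cancel]
    push_cast
    field_simp
  rw [integral_eq_sub_of_hasDerivAt (fun x _ => hderiv x)
    (Continuous.intervalIntegrable (by fun_prop) _ _)]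
  simp

lemma iterPrimitive_succ_sinPow_le (n N : ℕ) {s : ℝ} (hs : s ∈ Set.Icc 0 π) :
    iterPrimitive (n + 1) (sinPow N) s
      ≤ 2 * π ^ (n + 1) * (wallisRatio N / (2 * N + 1)) * sin (s / 2) := by
  have hsin : 0 ≤ sin (s / 2) := sin_nonneg_of_nonneg_of_le_pi (by linarith [hs.1])
    (by linarith [hs.2, pi_pos])
  calc iterPrimitive (n + 1) (sinPow N) s
      ≤ ∫ y in 0..s, π ^ (n + 1) * wallisRatio N * (cos (y / 2) * sin (y / 2) ^ (2 * N)) := by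
        refine integral_mono_on hs.1 (Continuous.intervalIntegrable (by fun_prop) _ _)
          (Continuous.intervalIntegrable (by fun_prop) _ _) fun y hy => ?_
        refine (mul_le_mul_of_nonneg_right (dividedPow_succ_sub_le hs.2 hy)
          (sinPow_nonneg N y)).trans_eq ?_
        rw [sinPow]
        ring
    _ = 2 * π ^ (n + 1) * (wallisRatio N / (2 * N + 1)) * sin (s / 2) ^ (2 * N + 1) := by
        rw [intervalIntegral.integral_const_mul, integral_cos_half_mul_sin_half_pow]
        ring
    _ ≤ 2 * π ^ (n + 1) * (wallisRatio N / (2 * N + 1)) * sin (s / 2) := by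
        have := wallisRatio_pos N
        gcongr
        exact pow_le_of_le_one hsin (sin_le_one _) (by omega)

/-! ### Integrals for the tails -/

/-- The tails of the series `ζ({2}^d)`, as an integral: the sum over the tuples above `N`. -/
noncomputable def twosTail (d N : ℕ) : ℝ := π⁻¹ * iterPrimitive (2 * d) (sinPow N) π

lemma twosTail_zero_left (N : ℕ) : twosTail 0 N = 1 := by
  rw [twosTail, mul_zero, iterPrimitive_zero_sinPow_pi, inv_mul_cancel₀ pi_ne_zero]

lemma twosTail_zero_right (d : ℕ) : twosTail d 0 = π⁻¹ * dividedPow (2 * d + 1) π := by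
  rw [twosTail, sinPow_zero, iterPrimitive_one]

lemma twosTail_sub (d N : ℕ) :
    twosTail (d + 1) N - twosTail (d + 1) (N + 1)
      = twosTail d (N + 1) / ((N + 1 : ℕ) : ℝ) ^ 2 := by
  rw [twosTail, twosTail, ← mul_sub, mul_add, mul_one, iterPrimitive_add_two_sinPow_sub, twosTail,
    Nat.cast_succ, mul_div_assoc]

lemma tendsto_twosTail_succ (d : ℕ) : Tendsto (twosTail (d + 1)) atTop (𝓝 0) := by
  have hbound (N : ℕ) : twosTail (d + 1) N
      ≤ π⁻¹ * (2 * π ^ (2 * d + 1 + 1)) * (wallisRatio N / (2 * N + 1)) := by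
    rw [twosTail, mul_assoc]
    refine mul_le_mul_of_nonneg_left ?_ (inv_nonneg.2 pi_pos.le)
    have hle := iterPrimitive_succ_sinPow_le (2 * d + 1) N ⟨pi_pos.le, le_rfl⟩
    rwa [sin_pi_div_two, mul_one] at hle
  refine squeeze_zero (fun N => ?_) hbound (by simpa using tendsto_wallisRatio_div.const_mul _)
  exact mul_nonneg (inv_nonneg.2 pi_pos.le) (iterPrimitive_nonneg _ (sinPow_nonneg N) pi_pos.le)

lemma hasSum_tailTerm_twos (d N : ℕ) : HasSum (tailTerm N (twos d)) (twosTail d N) := by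
  induction d generalizing N with
  | zero => exact (twosTail_zero_left N).symm ▸ hasSum_tailTerm_nil N
  | succ d ih =>
    exact hasSum_tailTerm_cons_of_sub_eq ih (tendsto_twosTail_succ d) (twosTail_sub d) N

/-- The weight of the integral for the tails of `ζ({2}^r, 3, {2}^s)`. Since `cot 0 = 0` by the
convention on division by zero, it vanishes at `θ = 0`, where it should have a pole. -/
noncomputable def cotWeight (m : ℕ) (θ : ℝ) : ℝ := dividedPow m (π - θ) * cot (θ / 2)

lemma measurable_cotWeight (m : ℕ) : Measurable (cotWeight m) := by
  unfold cotWeight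
  simp only [cot_eq_cos_div_sin]
  fun_prop

lemma sinPow_succ_mul_cot (N : ℕ) (θ : ℝ) :
    sinPow (N + 1) θ * cot (θ / 2) = sinPowDeriv N θ / (N + 1) := by
  rw [sinPow, sinPowDeriv, cot_eq_cos_div_sin]
  rcases eq_or_ne (sin (θ / 2)) 0 with h | h
  · simp [h]
  · field_simp
    ring

lemma integral_sinPow_succ_mul_cotWeight_succ (m N : ℕ) :
    ∫ θ in 0..π, sinPow (N + 1) θ * cotWeight (m + 1) θ
      = iterPrimitive m (sinPow (N + 1)) π / (N + 1) := by
  rw [← iterPrimitive_succ_deriv m (hasDerivAt_sinPow_succ N) (by fun_prop) (sinPow_succ_zero N),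
    iterPrimitive, ← intervalIntegral.integral_div]
  refine integral_congr fun θ _ => ?_
  simp only [cotWeight]
  rw [mul_left_comm, sinPow_succ_mul_cot, mul_div_assoc]

lemma norm_iterPrimitive_sinPow_mul_cotWeight_le (n m N : ℕ) {θ : ℝ} (hθ : θ ∈ Set.Ioc 0 π) :
    ‖iterPrimitive (n + 1) (sinPow N) θ * cotWeight m θ‖
      ≤ 2 * π ^ (n + 1) * π ^ m * (wallisRatio N / (2 * N + 1)) := by
  have hsin : 0 < sin (θ / 2) := sin_pos_of_pos_of_lt_pi (by linarith [hθ.1])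
    (by linarith [hθ.2, pi_pos])
  have hcos : 0 ≤ cos (θ / 2) := cos_nonneg_of_mem_Icc ⟨by linarith [hθ.1, pi_pos],
    by linarith [hθ.2]⟩
  have hpow : dividedPow m (π - θ) ≤ π ^ m :=
    (dividedPow_le_pow m (sub_nonneg.2 hθ.2)).trans
      (pow_le_pow_left₀ (sub_nonneg.2 hθ.2) (by linarith [hθ.1]) m)
  have hcot : 0 ≤ cot (θ / 2) := by rw [cot_eq_cos_div_sin]; positivity
  have hweight : 0 ≤ cotWeight m θ := mul_nonneg (dividedPow_nonneg m (sub_nonneg.2 hθ.2)) hcot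
  have hratio : 0 ≤ wallisRatio N / (2 * N + 1) :=
    div_nonneg (wallisRatio_pos N).le (by positivity)
  rw [norm_of_nonneg (mul_nonneg (iterPrimitive_nonneg _ (sinPow_nonneg N) hθ.1.le) hweight)]
  calc iterPrimitive (n + 1) (sinPow N) θ * cotWeight m θ
      ≤ 2 * π ^ (n + 1) * (wallisRatio N / (2 * N + 1)) * sin (θ / 2)
          * (π ^ m * cot (θ / 2)) := by
        have := iterPrimitive_succ_sinPow_le n N (Set.Ioc_subset_Icc_self hθ)
        rw [cotWeight] at hweight ⊢
        gcongr
    _ = 2 * π ^ (n + 1) * π ^ m * (wallisRatio N / (2 * N + 1)) * cos (θ / 2) := by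
        rw [cot_eq_cos_div_sin]
        field_simp
    _ ≤ 2 * π ^ (n + 1) * π ^ m * (wallisRatio N / (2 * N + 1)) :=
        mul_le_of_le_one_right (by positivity) (cos_le_one _)

lemma intervalIntegrable_iterPrimitive_sinPow_mul_cotWeight (n m N : ℕ) :
    IntervalIntegrable (fun θ => iterPrimitive (n + 1) (sinPow N) θ * cotWeight m θ)
      volume 0 π := by
  have hmeas : Measurable fun θ => iterPrimitive (n + 1) (sinPow N) θ * cotWeight m θ :=
    (continuous_iterPrimitive _ (continuous_sinPow N)).measurable.mul (measurable_cotWeight m)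
  rw [intervalIntegrable_iff_integrableOn_Ioc_of_le pi_pos.le]
  exact .of_bound measure_Ioc_lt_top hmeas.aestronglyMeasurable _ <|
    ae_restrict_of_forall_mem measurableSet_Ioc fun θ =>
      norm_iterPrimitive_sinPow_mul_cotWeight_le n m N

/-- The tails of the series `ζ({2}^r, 3, {2}^s)`, as an integral: the sum over the tuples above
`N`. -/
noncomputable def hTail (r s N : ℕ) : ℝ :=
  π⁻¹ * ∫ θ in 0..π, iterPrimitive (2 * r + 1) (sinPow N) θ * cotWeight (2 * s + 1) θ

lemma tendsto_hTail (r s : ℕ) : Tendsto (hTail r s) atTop (𝓝 0) := by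
  have hbound (N : ℕ) := norm_integral_le_of_norm_le_const (a := 0) (b := π) fun θ hθ =>
    norm_iterPrimitive_sinPow_mul_cotWeight_le (2 * r) (2 * s + 1) N
      (Set.uIoc_of_le pi_pos.le ▸ hθ)
  have hlimit := (tendsto_wallisRatio_div.const_mul
    (2 * π ^ (2 * r + 1) * π ^ (2 * s + 1))).mul_const |π - 0|
  rw [mul_zero, zero_mul] at hlimit
  rw [← mul_zero π⁻¹]
  exact (squeeze_zero_norm hbound hlimit).const_mul π⁻¹

lemma hTail_sub (r s N : ℕ) :
    hTail r s N - hTail r s (N + 1) = π⁻¹ * ∫ θ in 0..π,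
      (iterPrimitive (2 * r + 1) (sinPow N) θ - iterPrimitive (2 * r + 1) (sinPow (N + 1)) θ)
        * cotWeight (2 * s + 1) θ := by
  simp only [hTail, sub_mul]
  rw [integral_sub (intervalIntegrable_iterPrimitive_sinPow_mul_cotWeight _ _ _)
    (intervalIntegrable_iterPrimitive_sinPow_mul_cotWeight _ _ _), mul_sub]

lemma hTail_zero_left_sub (s N : ℕ) :
    hTail 0 s N - hTail 0 s (N + 1) = twosTail s (N + 1) / ((N + 1 : ℕ) : ℝ) ^ 3 := by
  simp only [hTail_sub, mul_zero, zero_add, iterPrimitive_one_sinPow_sub, div_mul_eq_mul_div,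
    intervalIntegral.integral_div, integral_sinPow_succ_mul_cotWeight_succ, twosTail,
    Nat.cast_succ]
  field_simp

lemma hTail_succ_left_sub (r s N : ℕ) :
    hTail (r + 1) s N - hTail (r + 1) s (N + 1) = hTail r s (N + 1) / ((N + 1 : ℕ) : ℝ) ^ 2 := by
  rw [hTail_sub, hTail, Nat.cast_succ, mul_div_assoc, ← intervalIntegral.integral_div]
  simp only [show 2 * (r + 1) + 1 = 2 * r + 1 + 2 by ring, iterPrimitive_add_two_sinPow_sub,
    div_mul_eq_mul_div]

lemma hasSum_tailTerm_hIndex (r s N : ℕ) : HasSum (tailTerm N (hIndex r s)) (hTail r s N) := by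
  induction r generalizing N with
  | zero =>
    exact hasSum_tailTerm_cons_of_sub_eq (hasSum_tailTerm_twos s) (tendsto_hTail 0 s)
      (hTail_zero_left_sub s) N
  | succ r ih =>
    exact hasSum_tailTerm_cons_of_sub_eq ih (tendsto_hTail (r + 1) s) (hTail_succ_left_sub r s) N

/-! ### Integrals of a polynomial times the cotangent -/

lemma tendsto_integral_mul_cos_atTop {g : ℝ → ℝ} (hg : Integrable g) :
    Tendsto (fun t : ℝ => ∫ x, g x * cos (t * x)) atTop (𝓝 0) := by
  have hfreq : Tendsto (fun t : ℝ => t / (2 * π)) atTop (cocompact ℝ) :=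
    (tendsto_id.atTop_div_const (by positivity)).mono_right atTop_le_cocompact
  have hre := (Complex.continuous_re.tendsto 0).comp
    ((Real.tendsto_integral_exp_smul_cocompact fun x => (g x : ℂ)).comp hfreq)
  rw [Complex.zero_re] at hre
  refine hre.congr fun t => ?_
  have hint : Integrable fun x : ℝ => Real.fourierChar (-(x * (t / (2 * π)))) • (g x : ℂ) := by
    simpa [mul_comm] using (Real.fourierIntegral_convergent_iff (t / (2 * π))).2 hg.ofReal
  simp only [Function.comp_apply]
  rw [← Complex.reCLM_apply, ← Complex.reCLM.integral_comp_comm hint]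
  refine integral_congr_ae (.of_forall fun x => ?_)
  have harg : 2 * π * -(x * (t / (2 * π))) = -(t * x) := by field_simp
  simp only [Complex.reCLM_apply, Circle.smul_def, Real.fourierChar_apply, smul_eq_mul,
    Complex.re_mul_ofReal, Complex.exp_ofReal_mul_I_re, harg, cos_neg]
  exact mul_comm _ _

lemma tendsto_intervalIntegral_mul_cos_atTop {g : ℝ → ℝ} {a b : ℝ}
    (hg : IntervalIntegrable g volume a b) :
    Tendsto (fun t : ℝ => ∫ x in a..b, g x * cos (t * x)) atTop (𝓝 0) := by
  have hind : Integrable ((Set.uIoc a b).indicator g) :=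
    (integrable_indicator_iff measurableSet_uIoc).2 (intervalIntegrable_iff.1 hg)
  have hlim := (tendsto_integral_mul_cos_atTop hind).const_smul (if a ≤ b then 1 else -1 : ℝ)
  rw [smul_zero] at hlim
  refine hlim.congr fun t => ?_
  rw [intervalIntegral_eq_integral_uIoc, ← MeasureTheory.integral_indicator measurableSet_uIoc]
  simp only [Set.indicator_mul_left]

lemma sum_two_mul_sin_mul_sin_half (N : ℕ) (x : ℝ) :
    (∑ n ∈ Finset.range N, 2 * sin (n * x)) * sin (x / 2)
      = cos (x / 2) - cos ((N - 1 / 2) * x) := by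
  induction N with
  | zero =>
    rw [Finset.sum_range_zero, zero_mul, ← cos_neg (x / 2)]
    ring_nf
  | succ N ih =>
    rw [Finset.sum_range_succ, add_mul, ih, two_mul_sin_mul_sin]
    push_cast
    ring_nf

lemma sinc_pos {x : ℝ} (hx : x ∈ Set.Ico 0 π) : 0 < sinc x := by
  rcases hx.1.eq_or_lt with rfl | hpos
  · simp
  · rw [sinc_of_ne_zero hpos.ne']
    exact div_pos (sin_pos_of_pos_of_lt_pi hpos hx.2) hpos

lemma exists_continuousOn_mul_sin_half_eq_eval {P : ℝ[X]} (hP : P.eval 0 = 0) :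
    ∃ g : ℝ → ℝ, ContinuousOn g (Set.Icc 0 π) ∧
      ∀ x ∈ Set.Icc 0 π, P.eval x = g x * sin (x / 2) := by
  obtain ⟨Q, rfl⟩ : X ∣ P := by rwa [X_dvd_iff, coeff_zero_eq_eval_zero]
  have hsinc {x : ℝ} (hx : x ∈ Set.Icc 0 π) : sinc (x / 2) ≠ 0 :=
    (sinc_pos ⟨by linarith [hx.1], by linarith [hx.2, pi_pos]⟩).ne'
  refine ⟨fun x => 2 * Q.eval x / sinc (x / 2), ContinuousOn.div (by fun_prop)
    (continuous_sinc.comp (by fun_prop)).continuousOn fun x hx => hsinc hx, fun x hx => ?_⟩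
  have hsin : sin (x / 2) = x / 2 * sinc (x / 2) := by
    rcases eq_or_ne x 0 with rfl | hx0
    · simp
    · rw [sinc_of_ne_zero (by positivity)]
      field_simp
  rw [hsin, eval_mul, eval_X]
  field_simp [hsinc hx]

/-- The formal expansion `cot (θ / 2) = 2 ∑ sin (n θ)` may be integrated term by term against a
polynomial that cancels the pole. -/
lemma tendsto_sum_integral_eval_mul_sin {P : ℝ[X]} (hP : P.eval 0 = 0) :
    Tendsto (fun N : ℕ => ∑ n ∈ Finset.range N, 2 * ∫ x in 0..π, P.eval x * sin (n * x)) atTop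
      (𝓝 (∫ x in 0..π, P.eval x * cot (x / 2))) := by
  obtain ⟨g, hgcont, hg⟩ := exists_continuousOn_mul_sin_half_eq_eval hP
  rw [← Set.uIcc_of_le pi_pos.le] at hgcont hg
  have hgcos {u : ℝ → ℝ} (hu : Continuous u) :
      IntervalIntegrable (fun x => g x * cos (u x)) volume 0 π :=
    (hgcont.mul (continuous_cos.comp hu).continuousOn).intervalIntegrable
  have hpartial (N : ℕ) : ∑ n ∈ Finset.range N, 2 * ∫ x in 0..π, P.eval x * sin (n * x)
      = (∫ x in 0..π, g x * cos (x / 2)) - ∫ x in 0..π, g x * cos ((N - 1 / 2) * x) := by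
    rw [← integral_sub (hgcos (by fun_prop)) (hgcos (by fun_prop))]
    simp only [← intervalIntegral.integral_const_mul]
    rw [← intervalIntegral.integral_finsetSum
      fun n _ => Continuous.intervalIntegrable (by fun_prop) _ _]
    refine integral_congr fun x hx => ?_
    rw [← mul_sub, ← sum_two_mul_sin_mul_sin_half, Finset.sum_mul, Finset.mul_sum]
    exact Finset.sum_congr rfl fun n _ => by rw [hg x hx]; ring
  have hcot : ∫ x in 0..π, P.eval x * cot (x / 2) = ∫ x in 0..π, g x * cos (x / 2) := by
    refine integral_congr_Ioo_of_le pi_pos.le fun x hx => ?_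
    have hsin : 0 < sin (x / 2) := sin_pos_of_pos_of_lt_pi (by linarith [hx.1])
      (by linarith [hx.2, pi_pos])
    rw [hg x (Set.uIcc_of_le pi_pos.le ▸ Set.Ioo_subset_Icc_self hx), cot_eq_cos_div_sin]
    field_simp
  have hfreq : Tendsto (fun N : ℕ => (N : ℝ) - 1 / 2) atTop atTop :=
    tendsto_atTop_add_const_right _ _ tendsto_natCast_atTop_atTop
  simp only [hpartial, hcot]
  simpa using ((tendsto_intervalIntegral_mul_cos_atTop hgcont.intervalIntegrable).comp
    hfreq).const_sub (∫ x in 0..π, g x * cos (x / 2))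

lemma integral_eval_mul_sin (P : ℝ[X]) {n : ℕ} (hn : n ≠ 0) :
    ∫ x in 0..π, P.eval x * sin (n * x)
      = (P.eval 0 - (-1) ^ n * P.eval π) / n
        - (∫ x in 0..π, (derivative^[2] P).eval x * sin (n * x)) / n ^ 2 := by
  have hsin (x : ℝ) : HasDerivAt (fun x => sin (n * x)) (cos (n * x) * n) x := by
    simpa using ((hasDerivAt_id x).const_mul (n : ℝ)).sin
  have hcos (x : ℝ) : HasDerivAt (fun x => cos (n * x)) (-sin (n * x) * n) x := by
    simpa using ((hasDerivAt_id x).const_mul (n : ℝ)).cos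
  have hprimitive (x : ℝ) : HasDerivAt
      (fun x => P.derivative.eval x * sin (n * x) / n ^ 2 - P.eval x * cos (n * x) / n)
      (P.eval x * sin (n * x) + (derivative^[2] P).eval x * sin (n * x) / n ^ 2) x := by
    refine ((((P.derivative.hasDerivAt x).mul (hsin x)).div_const _).sub
      (((P.hasDerivAt x).mul (hcos x)).div_const _)).congr_deriv ?_
    simp only [Function.iterate_succ, Function.iterate_zero, Function.comp_apply, id]
    field_simp
    ring
  have hFTC := integral_eq_sub_of_hasDerivAt (a := 0) (b := π) (fun x _ => hprimitive x)
    (Continuous.intervalIntegrable (by fun_prop) _ _)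
  rw [integral_add (Continuous.intervalIntegrable (by fun_prop) _ _)
    (Continuous.intervalIntegrable (by fun_prop) _ _), intervalIntegral.integral_div,
    sin_nat_mul_pi, cos_nat_mul_pi] at hFTC
  simp only [mul_zero, sin_zero, cos_zero, zero_div, mul_one, zero_sub] at hFTC
  rw [eq_sub_iff_add_eq, hFTC]
  ring

lemma integral_eval_mul_sin_eq_sum {M : ℕ} {P : ℝ[X]} (hP : derivative^[2 * M] P = 0) (n : ℕ) :
    ∫ x in 0..π, P.eval x * sin (n * x)
      = ∑ j ∈ Finset.range M, (-1) ^ j * ((derivative^[2 * j] P).eval 0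
        - (-1) ^ n * (derivative^[2 * j] P).eval π) / (n : ℝ) ^ (2 * j + 1) := by
  rcases eq_or_ne n 0 with rfl | hn
  · simp
  induction M generalizing P with
  | zero =>
    obtain rfl : P = 0 := hP
    simp
  | succ M ih =>
    have hiterate (j : ℕ) : derivative^[2 * j] (derivative^[2] P) = derivative^[2 * (j + 1)] P :=
      (Function.iterate_add_apply _ _ _ _).symm
    rw [integral_eval_mul_sin P hn, ih ((hiterate M).trans hP), Finset.sum_range_succ',
      Finset.sum_div, add_comm, sub_eq_add_neg, ← Finset.sum_neg_distrib]
    simp only [hiterate, mul_zero, Function.iterate_zero, id, pow_zero, zero_add, pow_one, one_mul]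
    congr 1
    refine Finset.sum_congr rfl fun j _ => ?_
    field_simp
    ring

lemma hasSum_neg_one_pow_div_pow {k : ℕ} (hk : 1 < k) :
    HasSum (fun n : ℕ => (-1) ^ n / (n : ℝ) ^ k) ((2 / 2 ^ k - 1) * ∑' n : ℕ, 1 / (n : ℝ) ^ k) := by
  have hall := (Real.summable_one_div_nat_pow.2 hk).hasSum
  set Z := ∑' n : ℕ, 1 / (n : ℝ) ^ k
  have heven : HasSum (fun n : ℕ => 1 / ((2 * n : ℕ) : ℝ) ^ k) (Z / 2 ^ k) := by
    simpa only [Nat.cast_mul, Nat.cast_ofNat, mul_comm, mul_pow, div_div]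
      using hall.div_const (2 ^ k)
  have hodd : Summable fun n : ℕ => 1 / ((2 * n + 1 : ℕ) : ℝ) ^ k :=
    hall.summable.comp_injective (i := fun n => 2 * n + 1) fun a b h => by
      simpa using h
  have hsplit := (heven.even_add_odd (f := fun n : ℕ => 1 / (n : ℝ) ^ k) hodd.hasSum).unique hall
  have halternating := HasSum.even_add_odd (f := fun n : ℕ => (-1) ^ n / (n : ℝ) ^ k)
    (m := Z / 2 ^ k) (m' := -∑' n : ℕ, 1 / ((2 * n + 1 : ℕ) : ℝ) ^ k)
    (by simpa [pow_mul] using heven) (by simpa [pow_mul, pow_succ, neg_div] using hodd.hasSum.neg)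
  convert! halternating using 1
  linear_combination hsplit

lemma integral_eval_mul_cot {M : ℕ} {P : ℝ[X]} (h0 : P.eval 0 = 0) (hπ : P.eval π = 0)
    (hP : derivative^[2 * (M + 1)] P = 0) :
    ∫ x in 0..π, P.eval x * cot (x / 2)
      = 2 * ∑ k ∈ Finset.Icc 1 M, (-1) ^ k * ((derivative^[2 * k] P).eval 0
          + (1 - 1 / 2 ^ (2 * k)) * (derivative^[2 * k] P).eval π)
        * ∑' n : ℕ, 1 / (n : ℝ) ^ (2 * k + 1) := by
  have hsin (n : ℕ) : ∫ x in 0..π, P.eval x * sin (n * x)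
      = ∑ k ∈ Finset.Icc 1 M, (-1) ^ k * ((derivative^[2 * k] P).eval 0
        - (-1) ^ n * (derivative^[2 * k] P).eval π) / (n : ℝ) ^ (2 * k + 1) := by
    rw [integral_eval_mul_sin_eq_sum hP, Finset.range_eq_Ico,
      Finset.sum_eq_sum_Ico_succ_bot M.succ_pos]
    simp [h0, hπ, Finset.Ico_add_one_right_eq_Icc]
  have hterm {k : ℕ} (hk : k ∈ Finset.Icc 1 M) (A B : ℝ) :
      HasSum (fun n : ℕ => (-1) ^ k * (A - (-1) ^ n * B) / (n : ℝ) ^ (2 * k + 1))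
        ((-1) ^ k * (A + (1 - 1 / 2 ^ (2 * k)) * B) * ∑' n : ℕ, 1 / (n : ℝ) ^ (2 * k + 1)) := by
    have hk' : 1 < 2 * k + 1 := by have := (Finset.mem_Icc.1 hk).1; omega
    convert! (((Real.summable_one_div_nat_pow.2 hk').hasSum.mul_left A).sub
      ((hasSum_neg_one_pow_div_pow hk').mul_left B)).mul_left ((-1) ^ k) using 1
    · ext n
      ring
    · rw [pow_succ 2 (2 * k)]
      field_simp
      ring
  refine tendsto_nhds_unique (tendsto_sum_integral_eval_mul_sin h0) ?_
  simp only [← Finset.mul_sum, hsin]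
  exact ((hasSum_sum fun k hk => hterm hk _ _).mul_left 2).tendsto_sum_nat.congr fun N =>
    (Finset.mul_sum _ _ _).symm

/-- The polynomial `X ^ a / a! * (c - X) ^ b / b!`, which for `c = π` is the factor of `cot (θ / 2)`
in the integral for `ζ({2}^r, 3, {2}^s)`. -/
noncomputable def dividedPowProd (c : ℝ) (a b : ℕ) : ℝ[X] :=
  C (1 / (factorial a * factorial b : ℝ)) * (X ^ a * (C c - X) ^ b)

lemma eval_dividedPowProd (c : ℝ) (a b : ℕ) (x : ℝ) :
    (dividedPowProd c a b).eval x = dividedPow a x * dividedPow b (c - x) := by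
  simp only [dividedPowProd, dividedPow, eval_mul, eval_pow, eval_X, eval_C, eval_sub]
  ring

lemma natDegree_dividedPowProd_le (c : ℝ) (a b : ℕ) :
    (dividedPowProd c a b).natDegree ≤ a + b := by
  unfold dividedPowProd
  compute_degree

lemma dividedPowProd_comp_C_sub_X (c : ℝ) (a b : ℕ) :
    (dividedPowProd c a b).comp (C c - X) = dividedPowProd c b a := by
  simp only [dividedPowProd, mul_comp, C_comp, pow_comp, X_comp, sub_comp, sub_sub_cancel]
  rw [mul_comm (factorial a : ℝ), mul_comm (X ^ b)]

lemma iterate_derivative_comp_C_sub_X {R : Type*} [CommRing R] (c : R) (P : R[X]) (k : ℕ) :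
    derivative^[k] (P.comp (C c - X)) = (-1) ^ k * (derivative^[k] P).comp (C c - X) := by
  induction k generalizing P with
  | zero => simp
  | succ k ih => simp [ih (derivative P), derivative_comp, pow_succ]

lemma eval_zero_iterate_derivative {R : Type*} [Semiring R] (P : R[X]) (k : ℕ) :
    (derivative^[k] P).eval 0 = factorial k • P.coeff k := by
  rw [← coeff_zero_eq_eval_zero, coeff_iterate_derivative, zero_add, Nat.descFactorial_self]

lemma eval_zero_iterate_derivative_dividedPowProd (c : ℝ) {a b k : ℕ} (hk : k ≤ a + b) :
    (derivative^[k] (dividedPowProd c a b)).eval 0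
      = (-1) ^ (k + a) * (k.choose a * dividedPow (a + b - k) c) := by
  have hpow : (C c - X) ^ b = C ((-1) ^ b) * (X + C (-c)) ^ b := by
    rw [C_neg, ← sub_eq_add_neg, ← neg_sub, neg_pow, C_pow, C_neg, C_1]
  rw [eval_zero_iterate_derivative, dividedPowProd, hpow, coeff_C_mul, coeff_X_pow_mul',
    coeff_C_mul, coeff_X_add_C_pow]
  split_ifs with hak
  · obtain ⟨i, rfl⟩ := Nat.exists_eq_add_of_le hak
    obtain ⟨j, rfl⟩ := Nat.exists_eq_add_of_le (Nat.le_of_add_le_add_left hk)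
    have hsign : (-1 : ℝ) ^ (i + j) * (-1) ^ j = (-1) ^ (a + i + a) := by
      rw [← pow_add, show i + j + j = i + 2 * j by ring, show a + i + a = i + 2 * a by ring]
      simp [pow_add, pow_mul]
    rw [Nat.add_sub_cancel_left, Nat.add_sub_cancel_left, ← add_assoc, Nat.add_sub_cancel_left,
      Nat.cast_add_choose, Nat.cast_add_choose, neg_pow c, dividedPow, nsmul_eq_mul, ← hsign]
    field_simp
  · rw [Nat.choose_eq_zero_of_lt (not_le.1 hak)]
    simp

lemma eval_iterate_derivative_dividedPowProd (c : ℝ) {a b k : ℕ} (hk : k ≤ a + b) :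
    (derivative^[k] (dividedPowProd c a b)).eval c
      = (-1) ^ b * (k.choose b * dividedPow (a + b - k) c) := by
  have hsign : (-1 : ℝ) ^ k * (-1) ^ (k + b) = (-1) ^ b := by
    rw [← pow_add, ← add_assoc, ← two_mul, pow_add, pow_mul]
    simp
  rw [← dividedPowProd_comp_C_sub_X, iterate_derivative_comp_C_sub_X, eval_mul, eval_comp,
    eval_sub, eval_C, eval_X, sub_self,
    eval_zero_iterate_derivative_dividedPowProd c (hk.trans_eq (add_comm a b)), add_comm b a,
    eval_pow, eval_neg, eval_one, ← mul_assoc, hsign]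

lemma hTail_zero (r s : ℕ) :
    hTail r s 0 = 2 * ∑ k ∈ Finset.Icc 1 (r + s + 1), (-1) ^ k * (zagierCoeff k r s : ℝ)
      * (∑' n : ℕ, 1 / (n : ℝ) ^ (2 * k + 1)) * twosTail (r + s + 1 - k) 0 := by
  have hdegree : (dividedPowProd π (2 * r + 2) (2 * s + 1)).natDegree < 2 * (r + s + 1 + 1) :=
    (natDegree_dividedPowProd_le _ _ _).trans_lt (by omega)
  have hintegrand (θ : ℝ) : iterPrimitive (2 * r + 1) (sinPow 0) θ * cotWeight (2 * s + 1) θ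
      = (dividedPowProd π (2 * r + 2) (2 * s + 1)).eval θ * cot (θ / 2) := by
    rw [sinPow_zero, iterPrimitive_one, eval_dividedPowProd, cotWeight, mul_assoc]
  simp only [hTail, hintegrand]
  rw [integral_eval_mul_cot (by simp [eval_dividedPowProd]) (by simp [eval_dividedPowProd])
    (iterate_derivative_eq_zero hdegree), mul_left_comm, Finset.mul_sum]
  congr 1
  refine Finset.sum_congr rfl fun k hk => ?_
  have hk' : k ≤ r + s + 1 := (Finset.mem_Icc.1 hk).2
  have horder : 2 * r + 2 + (2 * s + 1) - 2 * k = 2 * (r + s + 1 - k) + 1 := by omega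
  have heven : (-1 : ℝ) ^ (2 * k + (2 * r + 2)) = 1 :=
    Even.neg_one_pow ⟨k + r + 1, by ring⟩
  have hodd : (-1 : ℝ) ^ (2 * s + 1) = -1 := Odd.neg_one_pow ⟨s, rfl⟩
  rw [eval_zero_iterate_derivative_dividedPowProd π (by omega),
    eval_iterate_derivative_dividedPowProd π (by omega), horder, heven, hodd,
    twosTail_zero_right, zagierCoeff]
  push_cast
  ring

lemma riemannZeta_natCast_eq_ofReal_tsum {k : ℕ} (hk : 1 < k) :
    riemannZeta k = ((∑' n : ℕ, 1 / (n : ℝ) ^ k : ℝ) : ℂ) := by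
  rw [zeta_nat_eq_tsum_of_gt_one hk, Complex.ofReal_tsum]
  push_cast
  rfl

end

/-- The multiple zeta series involved converge (absolutely), and their values satisfy Zagier's
formula. -/
theorem theorem1p1 (r s : ℕ) :
    Summable (mzvTerm (hIndex r s)) ∧
    (∀ d : ℕ, Summable (mzvTerm (twos d))) ∧
    (zagierH r s : ℂ) =
      2 * ∑ k ∈ Finset.Icc 1 (r + s + 1),
        (-1 : ℂ) ^ k * (zagierCoeff k r s : ℂ) * riemannZeta (2 * (k : ℂ) + 1) *
          (mzv (twos (r + s + 1 - k)) : ℂ) := by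
  have hH : HasSum (mzvTerm (hIndex r s)) (hTail r s 0) := hasSum_tailTerm_hIndex r s 0
  have htwos (d : ℕ) : HasSum (mzvTerm (twos d)) (twosTail d 0) := hasSum_tailTerm_twos d 0
  have hmzv (d : ℕ) : mzv (twos d) = twosTail d 0 := (htwos d).tsum_eq
  refine ⟨hH.summable, fun d => (htwos d).summable, ?_⟩
  rw [zagierH, mzv, hH.tsum_eq, hTail_zero]
  push_cast
  congr 1
  refine Finset.sum_congr rfl fun k hk => ?_
  have hzeta := riemannZeta_natCast_eq_ofReal_tsum (k := 2 * k + 1)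
    (by have := (Finset.mem_Icc.1 hk).1; omega)
  push_cast at hzeta
  rw [hzeta, hmzv]
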